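/- For a non-integer real number $\beta>1$ let $\tau_\beta:[0,1]\to[0,1]$, $\tau_\beta(x)=1-\{\beta x\}$, be the negative $\beta$-transformation, where $\{y\}$ is the fractional part of $y$. Call $\beta$ an *Yrrap number* if the orbit $\{\tau_\beta^n(1):n\ge 0\}$ is finite, and a *simple* Yrrap number if moreover $\tau_\beta^n(1)\in EP_\beta:=\{1/\beta,2/\beta,\dots,\lfloor\beta\rfloor/\beta\}$ for some $n\ge1$. Yrrap numbers are algebraic; by a Galois conjugate of $\beta$ we mean a complex root, different from $\beta$, of the minimal polynomial of $\beta$ over $\mathbb{Q}$. Put $d_n=1+\lfloor\beta\,\tau_\beta^n(1)\rfloor$ and define the power series $$\phi_\beta(z)=\sum_{n=0}^{\infty}(-1)^n d_n z^{n+1}$$ if $\tau_\beta^n(1)\notin EP_\beta$ for all $n\ge1$, and otherwise $$\phi_\beta(z)=\sum_{n=0}^{N-1}(-1)^n d_n z^{n+1}+(-1)^N\beta\,\tau_\beta^N(1)\,z^{N+1},\qquad N=\min\{n\ge1:\tau_\beta^n(1)\in EP_\beta\}.$$ By a zero of $1-\phi_\beta$ we mean a point $z\in\mathbb{C}$ at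 which the power series converges and $1-\phi_\beta(z)=0$, or, if the series is the expansion at $0$ of a rational function, a zero of the rational function that extends $1-\phi_\beta$. The point $1/\beta$ is always such a zero. Let $\mathbb{D}$ be the open unit disk in $\mathbb{C}$ and let $\mathcal{G}_{[0,1]}$ be the set of all $z\in\mathbb{D}$ for which there are $a_1,a_2,\dots\in[0,1]$ with $1+\sum_{n\ge1}a_nz^n=0$. Let * $\Phi$ be the closure in $\mathbb{C}$ of the set of all Galois conjugates of simple Yrrap numbers, * $\hat\Phi$ be the closure of the set of all Galois conjugates of Yrrap numbers, * $\Phi^*$ be the closure of the set of all $z^{-1}$, where $z\ne1/\beta$ is a zero of $1-\phi_\beta$ for some non-integer $\beta>1$. Then $$\Phi=\hat\Phi=\Phi^*=\overline{\mathbb{D}}\cup\{-z^{-1}: z\in\mathcal{G}_{[0,1]}\}.$$ -/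

import Mathlib

open scoped Pointwise

noncomputable section

namespace GenBeta

/-- The bases under consideration: non-integer real numbers `β > 1`. -/
def IsBase (β : ℝ) : Prop := 1 < β ∧ ∀ k : ℤ, β ≠ k

/-- `I_β(x) = [βx]`, for `x ∈ [0,1]`. -/
def branch (β x : ℝ) : ℕ := ⌊β * x⌋₊

/-- The map `τ_{β,E}(x) = E(I_β(x)) + (-1)^{E(I_β(x))} {βx}`, which sends `[0,1]` to itself.
Only its values on `[0,1]` matter below. -/
def tau (β : ℝ) (E : ℕ → Fin 2) (x : ℝ) : ℝ :=
  ((E (branch β x) : ℕ) : ℝ) + (-1) ^ (E (branch β x) : ℕ) * Int.fract (β * x)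

/-- The `n`-th point `τ_{β,E}^n(1)` of the orbit of `1`. -/
def orbitPt (β : ℝ) (E : ℕ → Fin 2) (n : ℕ) : ℝ := (tau β E)^[n] 1

/-- The digit `d_n(β,E,1)`. -/
def digit (β : ℝ) (E : ℕ → Fin 2) (n : ℕ) : ℕ :=
  (E (branch β (orbitPt β E n)) : ℕ) + branch β (orbitPt β E n)

/-- The sign `e_n(β,E,1)`. -/
def sgn (β : ℝ) (E : ℕ → Fin 2) (n : ℕ) : ℤ :=
  (-1) ^ (E (branch β (orbitPt β E n)) : ℕ)

/-- The cumulative sign `s_n(β,E,1)`. -/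
def cumSgn (β : ℝ) (E : ℕ → Fin 2) (n : ℕ) : ℤ :=
  ∏ i ∈ Finset.range n, sgn β E i

/-- The interior end points `1/β, …, [β]/β` of the monotone pieces. -/
def endPts (β : ℝ) : Set ℝ := {x | ∃ k : ℕ, 1 ≤ k ∧ k ≤ ⌊β⌋₊ ∧ x = k / β}

/-- The positive times at which the orbit of `1` is in `EP`. -/
def hitTimes (β : ℝ) (E : ℕ → Fin 2) : Set ℕ :=
  {n | 1 ≤ n ∧ orbitPt β E n ∈ endPts β}

/-- The orbit of `1` eventually falls to `EP`. -/
def IsSimple (β : ℝ) (E : ℕ → Fin 2) : Prop := (hitTimes β E).Nonempty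

/-- `β` is a generalized Parry number with respect to `E`: the orbit of `1` is a finite set. -/
def IsGenParry (β : ℝ) (E : ℕ → Fin 2) : Prop :=
  IsBase β ∧ (Set.range (orbitPt β E)).Finite

/-- `β` is a simple generalized Parry number with respect to `E`. -/
def IsSimpleGenParry (β : ℝ) (E : ℕ → Fin 2) : Prop :=
  IsGenParry β E ∧ IsSimple β E

/-- The Galois conjugates of `β` in `ℂ`, other than `β` itself. -/
def galoisConjugates (β : ℝ) : Set ℂ :=
  {z | z ∈ (minpoly ℚ β).rootSet ℂ ∧ z ≠ (β : ℂ)}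

/-- `Φ(E)`. -/
def Phi (E : ℕ → Fin 2) : Set ℂ :=
  closure {z | ∃ β : ℝ, IsSimpleGenParry β E ∧ z ∈ galoisConjugates β}

/-- `Φ̂(E)`. -/
def PhiHat (E : ℕ → Fin 2) : Set ℂ :=
  closure {z | ∃ β : ℝ, IsGenParry β E ∧ z ∈ galoisConjugates β}

open Classical in
/-- The power series `φ_{τ_{β,E}}`. In the simple case it is a polynomial of degree `N + 1`, with
`N = sInf (hitTimes β E)` the first time `n ≥ 1` at which the orbit of `1` is in `EP`. -/
def phi (β : ℝ) (E : ℕ → Fin 2) : PowerSeries ℝ :=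
  PowerSeries.mk fun m =>
    match m with
    | 0 => 0
    | n + 1 =>
      if IsSimple β E then
        if n < sInf (hitTimes β E) then (cumSgn β E n : ℝ) * digit β E n
        else if n = sInf (hitTimes β E) then β * orbitPt β E n * cumSgn β E n
        else 0
      else (cumSgn β E n : ℝ) * digit β E n

/-- The power series `f` converges at `z`, and its sum there is `0`. -/
def SumsToZeroAt (f : PowerSeries ℝ) (z : ℂ) : Prop :=
  HasSum (fun n : ℕ => ((PowerSeries.coeff n f : ℝ) : ℂ) * z ^ n) 0

/-- `f` is the expansion at `0` of a rational function `P / Q` which has a zero at `z`. -/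
def RationalExtensionVanishesAt (f : PowerSeries ℝ) (z : ℂ) : Prop :=
  ∃ P Q : Polynomial ℝ, (Q : PowerSeries ℝ) * f = (P : PowerSeries ℝ) ∧
    Polynomial.aeval z Q ≠ 0 ∧ Polynomial.aeval z P = 0

/-- `z` is a zero of `f`, where `f` is regarded as a function on its domain of convergence and,
if it is the expansion of a rational function, on the domain of that function. -/
def IsZeroOf (f : PowerSeries ℝ) (z : ℂ) : Prop :=
  SumsToZeroAt f z ∨ RationalExtensionVanishesAt f z

/-- `Φ*(E)`: the closure of the set of inverses of the zeros of `1 - φ_{τ_{β,E}}`, for all `β`,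
other than the zero `1/β` that is always there. -/
def PhiStar (E : ℕ → Fin 2) : Set ℂ :=
  closure {w | ∃ β : ℝ, IsBase β ∧ ∃ z : ℂ,
    IsZeroOf (1 - phi β E) z ∧ z ≠ (β : ℂ)⁻¹ ∧ w = z⁻¹}

/-- `𝓕_I`: the power series with constant term `1` and all other coefficients in `I`. -/
def seriesClass (I : Set ℝ) : Set (PowerSeries ℝ) :=
  {f | PowerSeries.coeff 0 f = 1 ∧ ∀ n : ℕ, 1 ≤ n → PowerSeries.coeff n f ∈ I}

/-- `𝓖_I`: the zeros in the open unit disk of the power series in `𝓕_I`. -/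
def zeroSet (I : Set ℝ) : Set ℂ :=
  {z | z ∈ Metric.ball (0 : ℂ) 1 ∧ ∃ f ∈ seriesClass I, SumsToZeroAt f z}

/-- `E_1 = (1, 1, 1, …)`; the maps `τ_{β,E_1}` are the negative `β`-transformations
`x ↦ 1 - {βx}`. -/
def E₁ : ℕ → Fin 2 := fun _ => 1

end GenBeta

end

/-
For every `E`, the recursion `β xₙ = dₙ + eₙ xₙ₊₁` for the orbit `xₙ = τⁿ(1)` gives the
factorization `1 - φ = (1 - βz) ∑ sₙ xₙ zⁿ`. For `E₁` the signs `sₙ` alternate, so a zero `z ≠ 1/β`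
of `1 - φ` in the unit disk makes `-z` a zero of `∑ xₙ zⁿ` with `xₙ ∈ [0, 1]`; conjugates of
absolute value greater than one are inverses of such zeros because `1 - φ` has integer coefficients.

Conversely, the digits of a simple number can be prescribed so that a large multiple of any monic
polynomial `P` with coefficients in `[0, 1]` is approximated by a polynomial which is irreducible by
Eisenstein's criterion and vanishes at `-β`. By Hurwitz's theorem its other roots, the negatives of
the conjugates of `β`, come near those of `P`. The roots of the polynomials `P` accumulate at every
point of the unit disk, by `X ^ m + r ^ m`, and at the inverses of the zeros of power series, by
reversed truncations.
-/

namespace GenBeta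

open Filter Topology
open scoped Polynomial PowerSeries

section Orbit

variable (β : ℝ) (E : ℕ → Fin 2)

theorem orbitPt_zero : orbitPt β E 0 = 1 := rfl

theorem orbitPt_succ (n : ℕ) : orbitPt β E (n + 1) = tau β E (orbitPt β E n) :=
  Function.iterate_succ_apply' _ _ _

theorem cumSgn_succ (n : ℕ) : cumSgn β E (n + 1) = cumSgn β E n * sgn β E n :=
  Finset.prod_range_succ _ _

theorem cumSgn_E₁ (n : ℕ) : cumSgn β E₁ n = (-1) ^ n := by
  simp [cumSgn, sgn, E₁]

theorem abs_cumSgn (n : ℕ) : |cumSgn β E n| = 1 := by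
  simp [cumSgn, sgn, Finset.abs_prod]

theorem tau_E₁ (x : ℝ) : tau β E₁ x = 1 - Int.fract (β * x) := by
  simp only [tau, E₁, Fin.val_one, Nat.cast_one, pow_one]
  ring

theorem tau_mem_Icc (x : ℝ) : tau β E x ∈ Set.Icc (0 : ℝ) 1 := by
  have hfract : Int.fract (β * x) ∈ Set.Icc (0 : ℝ) 1 :=
    ⟨Int.fract_nonneg _, (Int.fract_lt_one _).le⟩
  unfold tau
  generalize E (branch β x) = e
  fin_cases e
  · simpa using hfract
  · simpa [and_comm] using hfract

theorem orbitPt_mem_Icc (n : ℕ) : orbitPt β E n ∈ Set.Icc (0 : ℝ) 1 := by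
  cases n with
  | zero => simp [orbitPt_zero]
  | succ n => exact orbitPt_succ β E n ▸ tau_mem_Icc β E _

variable {β} {E}

theorem mul_orbitPt_eq (hβ : 0 ≤ β) (n : ℕ) :
    β * orbitPt β E n = digit β E n + sgn β E n * orbitPt β E (n + 1) := by
  have h : 0 ≤ β * orbitPt β E n := mul_nonneg hβ (orbitPt_mem_Icc β E n).1
  have hfract : Int.fract (β * orbitPt β E n) = β * orbitPt β E n - branch β (orbitPt β E n) := by
    rw [Int.fract, branch, natCast_floor_eq_intCast_floor h]
  rw [orbitPt_succ, tau, digit, sgn, hfract]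
  generalize E (branch β (orbitPt β E n)) = e
  fin_cases e
  · simp
  · simp
    ring

theorem tau_mem_of_mul_eq_natCast {x : ℝ} {k : ℕ} (h : β * x = k) :
    tau β E x = 0 ∨ tau β E x = 1 := by
  rw [tau, h, Int.fract_natCast, mul_zero, add_zero]
  generalize E (branch β x) = e
  fin_cases e <;> simp

/-- An end point of a piece is sent to `0` or `1`, and so is `0`. -/
theorem finite_range_orbitPt_of_isSimple (hβ : 0 < β) (h : IsSimple β E) :
    (Set.range (orbitPt β E)).Finite := by
  obtain ⟨N, -, k, -, -, hk⟩ := h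
  refine (((Finset.range (N + 1)).image (orbitPt β E)).finite_toSet.union
    (Set.finite_singleton 0)).subset ?_
  have h₁ : ∃ m ≤ N, orbitPt β E m = 1 := ⟨0, N.zero_le, rfl⟩
  have hstep (n : ℕ) : (∃ m ≤ N, orbitPt β E m = orbitPt β E n) ∨ orbitPt β E n = 0 := by
    induction n with
    | zero => exact Or.inl h₁
    | succ n ih =>
      have hend {j : ℕ} (hj : β * orbitPt β E n = j) :
          (∃ m ≤ N, orbitPt β E m = orbitPt β E (n + 1)) ∨ orbitPt β E (n + 1) = 0 := by
        rw [orbitPt_succ]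
        obtain h | h := tau_mem_of_mul_eq_natCast (E := E) hj
        · exact Or.inr h
        · exact Or.inl (h ▸ h₁)
      obtain ⟨m, hm, hmn⟩ | hn := ih
      · obtain hm | rfl := hm.lt_or_eq
        · exact Or.inl ⟨m + 1, hm, by rw [orbitPt_succ, orbitPt_succ, hmn]⟩
        · exact hend (j := k) (by rw [← hmn, hk, mul_div_cancel₀ _ hβ.ne'])
      · exact hend (j := 0) (by simp [hn])
  rintro _ ⟨n, rfl⟩
  simpa [Nat.lt_succ_iff] using (hstep n).symm

end Orbit

section OrbitSeries

open Classical in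
/-- The series `∑ sₙ xₙ zⁿ` over the orbit `xₙ = τⁿ(1)` with its cumulative signs `sₙ`, stopped
after the first hitting time of an end point; it is the quotient of `1 - φ` by `1 - βz`. -/
noncomputable def orbitSeries (β : ℝ) (E : ℕ → Fin 2) : ℝ⟦X⟧ :=
  PowerSeries.mk fun n =>
    if IsSimple β E ∧ sInf (hitTimes β E) < n then 0 else cumSgn β E n * orbitPt β E n

variable {β : ℝ} {E : ℕ → Fin 2}

theorem one_sub_phi_eq (hβ : 0 ≤ β) :
    1 - phi β E =
      ((1 - Polynomial.C β * Polynomial.X : ℝ[X]) : ℝ⟦X⟧) * orbitSeries β E := by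
  have hrec (n : ℕ) : (cumSgn β E n : ℝ) * digit β E n =
      β * (cumSgn β E n * orbitPt β E n) - cumSgn β E (n + 1) * orbitPt β E (n + 1) := by
    rw [cumSgn_succ]
    push_cast
    linear_combination (-(cumSgn β E n : ℝ)) * mul_orbitPt_eq (E := E) hβ n
  ext n
  rw [Polynomial.coe_sub, Polynomial.coe_mul, Polynomial.coe_one, Polynomial.coe_C,
    Polynomial.coe_X, sub_mul, one_mul, mul_assoc, map_sub, map_sub]
  cases n with
  | zero => simp [phi, orbitSeries, cumSgn, orbitPt_zero]
  | succ n =>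
    simp only [PowerSeries.coeff_one, PowerSeries.coeff_C_mul, PowerSeries.coeff_succ_X_mul, phi,
      orbitSeries, PowerSeries.coeff_mk]
    by_cases hs : IsSimple β E
    · rcases lt_trichotomy n (sInf (hitTimes β E)) with h | h | h
      · simp [hs, h, h.not_gt, hrec]
      · simp [hs, ← h]
        ring
      · simp [hs, h, h.not_gt, h.ne', h.trans n.lt_succ_self]
    · simp [hs, hrec]

theorem abs_coeff_orbitSeries_le (n : ℕ) : |PowerSeries.coeff n (orbitSeries β E)| ≤ 1 := by
  rw [orbitSeries, PowerSeries.coeff_mk]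
  split_ifs
  · simp
  · rw [abs_mul, ← Int.cast_abs, abs_cumSgn, Int.cast_one, one_mul,
      abs_of_nonneg (orbitPt_mem_Icc β E n).1]
    exact (orbitPt_mem_Icc β E n).2

theorem rescale_neg_one_orbitSeries_mem_seriesClass :
    PowerSeries.rescale (-1) (orbitSeries β E₁) ∈ seriesClass (Set.Icc 0 1) := by
  refine ⟨by simp [orbitSeries, cumSgn, orbitPt_zero], fun n _ => ?_⟩
  rw [PowerSeries.coeff_rescale, orbitSeries, PowerSeries.coeff_mk]
  split_ifs
  · simp
  · rw [cumSgn_E₁, Int.cast_pow, Int.cast_neg, Int.cast_one, ← mul_assoc, ← mul_pow, neg_one_mul,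
      neg_neg, one_pow, one_mul]
    exact orbitPt_mem_Icc β E₁ n

theorem finite_range_coeff_orbitSeries (h : (Set.range (orbitPt β E)).Finite) :
    (Set.range fun n => PowerSeries.coeff n (orbitSeries β E)).Finite := by
  refine ((h.union (h.image Neg.neg)).union (Set.finite_singleton 0)).subset ?_
  rintro _ ⟨n, rfl⟩
  simp only [orbitSeries, PowerSeries.coeff_mk]
  split_ifs
  · simp
  · obtain hs | hs := eq_or_eq_neg_of_abs_eq (abs_cumSgn β E n) <;> simp [hs]

theorem finite_support_coeff_orbitSeries (h : IsSimple β E) :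
    (Function.support fun n => PowerSeries.coeff n (orbitSeries β E)).Finite := by
  refine (Set.finite_Iic (sInf (hitTimes β E))).subset fun n hn => ?_
  simp only [orbitSeries, PowerSeries.coeff_mk, Function.mem_support] at hn
  simpa [h] using fun hlt => hn (if_pos ⟨h, hlt⟩)

theorem coeff_one_sub_phi_mem_range (hβ : β ≠ 0) (n : ℕ) :
    PowerSeries.coeff n (1 - phi β E) ∈ Set.range ((↑) : ℤ → ℝ) := by
  cases n with
  | zero => exact ⟨1, by simp [phi]⟩
  | succ n =>
    have hend (h : IsSimple β E) : ∃ k : ℤ, β * orbitPt β E (sInf (hitTimes β E)) = k := by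
      obtain ⟨-, k, -, -, hk⟩ := Nat.sInf_mem h
      exact ⟨k, by rw [hk, mul_div_cancel₀ _ hβ]; rfl⟩
    simp only [phi, map_sub, PowerSeries.coeff_mk, PowerSeries.coeff_one, Nat.succ_ne_zero,
      if_false, zero_sub]
    split_ifs with hs hlt heq
    · exact ⟨-(cumSgn β E n * digit β E n), by push_cast; ring⟩
    · obtain ⟨k, hk⟩ := hend hs
      exact ⟨-(k * cumSgn β E n), by rw [heq, hk]; push_cast; ring⟩
    · exact ⟨0, by simp⟩
    · exact ⟨-(cumSgn β E n * digit β E n), by push_cast; ring⟩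

end OrbitSeries

section Evaluation

theorem hasSum_coeff_polynomial_mul {R S : Type*} [CommRing R] [CommRing S] [TopologicalSpace S]
    [IsTopologicalRing S] (φ : R →+* S) (Q : R[X]) {g : R⟦X⟧} {z s : S}
    (h : HasSum (fun n => φ (PowerSeries.coeff n g) * z ^ n) s) :
    HasSum (fun n => φ (PowerSeries.coeff n ((Q : R⟦X⟧) * g)) * z ^ n) (Q.eval₂ φ z * s) := by
  induction Q using Polynomial.induction_on with
  | C a =>
    simpa only [Polynomial.coe_C, PowerSeries.coeff_C_mul, Polynomial.eval₂_C, map_mul, mul_assoc]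
      using h.mul_left (φ a)
  | add P Q hP hQ =>
    simpa only [Polynomial.coe_add, add_mul, map_add, Polynomial.eval₂_add] using hP.add hQ
  | monomial n a ih =>
    have hX : ((Polynomial.C a * Polynomial.X ^ (n + 1) : R[X]) : R⟦X⟧) * g =
        PowerSeries.X * (((Polynomial.C a * Polynomial.X ^ n : R[X]) : R⟦X⟧) * g) := by
      rw [pow_succ, ← mul_assoc, Polynomial.coe_mul, Polynomial.coe_X, mul_comm _ PowerSeries.X,
        mul_assoc]
    have hshift : HasSum (fun m => φ (PowerSeries.coeff (m + 1) (PowerSeries.X *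
        (((Polynomial.C a * Polynomial.X ^ n : R[X]) : R⟦X⟧) * g))) * z ^ (m + 1))
        (z * ((Polynomial.C a * Polynomial.X ^ n).eval₂ φ z * s)) := by
      simpa only [PowerSeries.coeff_succ_X_mul, pow_succ', mul_left_comm z] using ih.mul_left z
    have hsum := hshift.zero_add (f := fun m => φ (PowerSeries.coeff m (PowerSeries.X *
      (((Polynomial.C a * Polynomial.X ^ n : R[X]) : R⟦X⟧) * g))) * z ^ m)
    rw [PowerSeries.coeff_zero_X_mul, map_zero, zero_mul, zero_add] at hsum
    have heval : (Polynomial.C a * Polynomial.X ^ (n + 1)).eval₂ φ z =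
        z * (Polynomial.C a * Polynomial.X ^ n).eval₂ φ z := by
      rw [pow_succ', mul_left_comm, Polynomial.eval₂_mul, Polynomial.eval₂_X]
    rwa [hX, heval, mul_assoc]

theorem IsZeroOf.eq_zero_of_hasSum {A : ℝ⟦X⟧} {R : ℝ[X]} {z s : ℂ}
    (h : IsZeroOf ((R : ℝ⟦X⟧) * A) z) (hR : Polynomial.aeval z R ≠ 0)
    (hA : HasSum (fun n => ((PowerSeries.coeff n A : ℝ) : ℂ) * z ^ n) s) : s = 0 := by
  have hRA := hasSum_coeff_polynomial_mul Complex.ofRealHom R hA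
  obtain h | ⟨P, Q, hPQ, hQ, hP⟩ := h
  · exact (mul_eq_zero.1 (hRA.unique h)).resolve_left hR
  · have hone : HasSum (fun n => Complex.ofRealHom (PowerSeries.coeff n (1 : ℝ⟦X⟧)) * z ^ n) 1 := by
      convert hasSum_ite_eq 0 (1 : ℂ) using 2 with n
      by_cases hn : n = 0 <;> simp [PowerSeries.coeff_one, hn]
    have hPsum := hasSum_coeff_polynomial_mul Complex.ofRealHom P hone
    rw [mul_one, mul_one, ← hPQ] at hPsum
    have hQsum := hasSum_coeff_polynomial_mul Complex.ofRealHom Q hRA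
    have hprod : Polynomial.aeval z Q * (Polynomial.aeval z R * s) = 0 :=
      (hQsum.unique hPsum).trans hP
    exact (mul_eq_zero.1 ((mul_eq_zero.1 hprod).resolve_left hQ)).resolve_left hR

theorem summable_norm_mul_pow {a : ℕ → ℂ} {C : ℝ} (ha : ∀ n, ‖a n‖ ≤ C) {z : ℂ} (hz : ‖z‖ < 1) :
    Summable fun n => ‖a n * z ^ n‖ := by
  refine summable_norm_mul_geometric_of_norm_lt_one' (k := 0) hz
    (Asymptotics.IsBigO.of_bound C (Eventually.of_forall fun n => ?_))
  simpa using ha n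

end Evaluation

section Conjugation

open IntermediateField

theorem exists_algHom_adjoin_simple_of_mem_rootSet {F E K : Type*} [Field F] [Field E] [Field K]
    [Algebra F E] [Algebra F K] {α : E} {γ : K} (hγ : γ ∈ (minpoly F α).rootSet K) :
    ∃ σ : F⟮α⟯ →ₐ[F] K, σ (AdjoinSimple.gen F α) = γ := by
  have hα : IsIntegral F α := by
    by_contra h
    simp [minpoly.eq_zero h] at hγ
  have hγ' : γ ∈ (minpoly F α).aroots K := by simpa [Polynomial.rootSet] using hγ
  exact ⟨(algHomAdjoinIntegralEquiv F hα).symm ⟨γ, hγ'⟩,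
    algHomAdjoinIntegralEquiv_symm_apply_gen F hα ⟨γ, hγ'⟩⟩

variable {β : ℝ} {f A : ℝ⟦X⟧}

theorem coeff_mem_adjoin_simple
    (hfA : f = ((1 - Polynomial.C β * Polynomial.X : ℝ[X]) : ℝ⟦X⟧) * A)
    (hf : ∀ n, PowerSeries.coeff n f ∈ Set.range ((↑) : ℚ → ℝ)) (n : ℕ) :
    PowerSeries.coeff n A ∈ ℚ⟮β⟯ := by
  have hA : A = f + PowerSeries.C β * (PowerSeries.X * A) := by
    rw [hfA, Polynomial.coe_sub, Polynomial.coe_one, Polynomial.coe_mul, Polynomial.coe_C,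
      Polynomial.coe_X]
    ring
  have hrat (n : ℕ) : PowerSeries.coeff n f ∈ ℚ⟮β⟯ := by
    obtain ⟨q, hq⟩ := hf n
    exact hq ▸ ℚ⟮β⟯.algebraMap_mem q
  induction n with
  | zero => rw [hA]; simpa using hrat 0
  | succ n ih =>
    rw [hA, map_add, PowerSeries.coeff_C_mul, PowerSeries.coeff_succ_X_mul]
    exact add_mem (hrat _) (mul_mem (mem_adjoin_simple_self ℚ β) ih)

theorem exists_lift_adjoin_simple
    (hfA : f = ((1 - Polynomial.C β * Polynomial.X : ℝ[X]) : ℝ⟦X⟧) * A)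
    (hf : ∀ n, PowerSeries.coeff n f ∈ Set.range ((↑) : ℚ → ℝ)) :
    ∃ a : ℚ⟮β⟯⟦X⟧, (∀ n, algebraMap ℚ⟮β⟯ ℝ (PowerSeries.coeff n a) = PowerSeries.coeff n A) ∧
      ∀ n, ∃ q : ℚ, (q : ℝ) = PowerSeries.coeff n f ∧
        PowerSeries.coeff n (((1 - Polynomial.C (AdjoinSimple.gen ℚ β) * Polynomial.X :
          ℚ⟮β⟯[X]) : ℚ⟮β⟯⟦X⟧) * a) = q := by
  let a : ℚ⟮β⟯⟦X⟧ := PowerSeries.mk fun n =>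
    ⟨PowerSeries.coeff n A, coeff_mem_adjoin_simple hfA hf n⟩
  have haA : a.map (algebraMap ℚ⟮β⟯ ℝ) = A := by
    ext n
    simp [a]
  refine ⟨a, fun n => by rw [← PowerSeries.coeff_map, haA], fun n => ?_⟩
  obtain ⟨q, hq⟩ := hf n
  refine ⟨q, hq, (algebraMap ℚ⟮β⟯ ℝ).injective ?_⟩
  rw [← PowerSeries.coeff_map, map_ratCast, hq, hfA]
  simp [haA]

/-- The embedding `ℚ(β) → ℂ` with `β ↦ γ` fixes `f` and turns the factor `1 - βz` into
`1 - γz`. -/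
theorem sumsToZeroAt_inv_of_mem_rootSet (hβ : β ≠ 0)
    (hfA : f = ((1 - Polynomial.C β * Polynomial.X : ℝ[X]) : ℝ⟦X⟧) * A)
    (hf : ∀ n, PowerSeries.coeff n f ∈ Set.range ((↑) : ℚ → ℝ))
    (hA : (Set.range fun n => PowerSeries.coeff n A).Finite) {γ : ℂ}
    (hγ : γ ∈ (minpoly ℚ β).rootSet ℂ)
    (h : 1 < ‖γ‖ ∨ (Function.support fun n => PowerSeries.coeff n A).Finite) :
    SumsToZeroAt f γ⁻¹ := by
  obtain ⟨σ, hσ⟩ := exists_algHom_adjoin_simple_of_mem_rootSet hγ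
  have hγ₀ : γ ≠ 0 := by
    rw [← hσ, map_ne_zero]
    exact fun h => hβ (congrArg Subtype.val h)
  obtain ⟨a, haA, hR⟩ := exists_lift_adjoin_simple hfA hf
  have hsum : Summable fun n => σ (PowerSeries.coeff n a) * γ⁻¹ ^ n := by
    obtain h | h := h
    · have hfin : (Set.range fun n => PowerSeries.coeff n a).Finite := by
        refine Set.Finite.of_finite_image (hA.subset ?_) (algebraMap ℚ⟮β⟯ ℝ).injective.injOn
        rintro _ ⟨_, ⟨n, rfl⟩, rfl⟩
        exact ⟨n, (haA n).symm⟩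
      obtain ⟨C, hC⟩ := (hfin.image σ).isBounded.exists_norm_le
      exact (summable_norm_mul_pow (fun n => hC _ ⟨_, ⟨n, rfl⟩, rfl⟩)
        (norm_inv γ ▸ inv_lt_one_of_one_lt₀ h)).of_norm
    · refine summable_of_hasFiniteSupport (h.subset fun n hn => ?_)
      simpa [← haA] using left_ne_zero_of_mul hn
  have key := hasSum_coeff_polynomial_mul (σ : ℚ⟮β⟯ →+* ℂ)
    (1 - Polynomial.C (AdjoinSimple.gen ℚ β) * Polynomial.X) hsum.hasSum
  have hzero : (1 - Polynomial.C (AdjoinSimple.gen ℚ β) * Polynomial.X).eval₂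
      (σ : ℚ⟮β⟯ →+* ℂ) γ⁻¹ = 0 := by
    simp [Polynomial.eval₂_sub, Polynomial.eval₂_mul, hσ, hγ₀]
  rw [hzero, zero_mul] at key
  refine (congrArg (HasSum · (0 : ℂ)) (funext fun n => ?_)).mp key
  obtain ⟨q, hq, hqa⟩ := hR n
  rw [hqa, ← hq, map_ratCast, Complex.ofReal_ratCast]

end Conjugation

section UpperBound

variable {β : ℝ} {E : ℕ → Fin 2} {γ z : ℂ}

theorem IsGenParry.isZeroOf_inv (hβ : IsGenParry β E) (hγ : γ ∈ galoisConjugates β)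
    (h : 1 < ‖γ‖ ∨ IsSimple β E) : IsZeroOf (1 - phi β E) γ⁻¹ := by
  have hβ₀ : 0 < β := one_pos.trans hβ.1.1
  refine Or.inl (sumsToZeroAt_inv_of_mem_rootSet hβ₀.ne' (one_sub_phi_eq hβ₀.le) (fun n => ?_)
    (finite_range_coeff_orbitSeries hβ.2) hγ.1 (h.imp_right finite_support_coeff_orbitSeries))
  obtain ⟨k, hk⟩ := coeff_one_sub_phi_mem_range (E := E) hβ₀.ne' n
  exact ⟨k, by rw [Rat.cast_intCast, hk]⟩

theorem neg_mem_zeroSet_of_isZeroOf (hβ : 0 < β) (hz : IsZeroOf (1 - phi β E₁) z)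
    (hzβ : z ≠ (β : ℂ)⁻¹) (hz₁ : ‖z‖ < 1) : -z ∈ zeroSet (Set.Icc 0 1) := by
  have hR : Polynomial.aeval z (1 - Polynomial.C β * Polynomial.X) ≠ 0 := by
    simpa [sub_eq_zero, eq_comm (a := (1 : ℂ))] using
      fun h => hzβ (eq_inv_of_mul_eq_one_right h)
  have hsum : Summable fun n => ((PowerSeries.coeff n (orbitSeries β E₁) : ℝ) : ℂ) * z ^ n := by
    refine (summable_norm_mul_pow (C := 1) (fun n => ?_) hz₁).of_norm
    simpa using abs_coeff_orbitSeries_le n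
  have hzero := hsum.hasSum
  rw [one_sub_phi_eq hβ.le] at hz
  rw [hz.eq_zero_of_hasSum hR hzero] at hzero
  refine ⟨by simpa using hz₁, _, rescale_neg_one_orbitSeries_mem_seriesClass (β := β), ?_⟩
  refine (congrArg (HasSum · (0 : ℂ)) (funext fun n => ?_)).mp hzero
  rw [PowerSeries.coeff_rescale, neg_pow z, Complex.ofReal_mul, mul_mul_mul_comm,
    Complex.ofReal_pow, Complex.ofReal_neg, Complex.ofReal_one, ← mul_pow, neg_one_mul, neg_neg,
    one_pow, one_mul]

end UpperBound

section Closed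

variable {I : Set ℝ}

theorem mem_zeroSet_iff {z : ℂ} :
    z ∈ zeroSet I ↔ ‖z‖ < 1 ∧ ∃ b : ℕ → ℝ, (∀ n, b n ∈ I) ∧
      HasSum (fun n => (b n : ℂ) * z ^ (n + 1)) (-1) := by
  have hshift {f : ℝ⟦X⟧} (hf : PowerSeries.coeff 0 f = 1) : SumsToZeroAt f z ↔
      HasSum (fun n => ((PowerSeries.coeff (n + 1) f : ℝ) : ℂ) * z ^ (n + 1)) (-1) := by
    rw [SumsToZeroAt, ← hasSum_nat_add_iff' 1]
    simp only [Finset.sum_range_one, hf, Complex.ofReal_one, pow_zero, mul_one, zero_sub]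
  rw [zeroSet, Set.mem_ofPred_eq, mem_ball_zero_iff]
  refine and_congr_right fun _ => ⟨?_, ?_⟩
  · rintro ⟨f, ⟨hf₀, hf⟩, hz⟩
    exact ⟨fun n => PowerSeries.coeff (n + 1) f, fun n => hf _ n.succ_pos, (hshift hf₀).1 hz⟩
  · rintro ⟨b, hb, hz⟩
    have hf₀ : PowerSeries.coeff 0 (1 + PowerSeries.X * PowerSeries.mk b) = 1 := by simp
    have hf (n : ℕ) : PowerSeries.coeff (n + 1) (1 + PowerSeries.X * PowerSeries.mk b) = b n := by
      simp [PowerSeries.coeff_one, PowerSeries.coeff_succ_X_mul]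
    refine ⟨_, ⟨hf₀, fun n hn => ?_⟩, (hshift hf₀).2 (by simpa only [hf] using hz)⟩
    obtain ⟨m, rfl⟩ := Nat.exists_eq_succ_of_ne_zero (Nat.one_le_iff_ne_zero.1 hn)
    exact (hf m).symm ▸ hb m

theorem isCompact_zeroSet_inter_closedBall (hI : IsCompact I) {ρ : ℝ} (hρ : ρ < 1) :
    IsCompact (zeroSet I ∩ Metric.closedBall 0 ρ) := by
  rcases lt_or_ge ρ 0 with hρ₀ | hρ₀
  · simp [Metric.closedBall_eq_empty.2 hρ₀]
  obtain ⟨C, hC⟩ := hI.isBounded.exists_norm_le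
  let K : Set ((ℕ → ℝ) × ℂ) := (Set.univ.pi fun _ => I) ×ˢ Metric.closedBall 0 ρ
  let F : (ℕ → ℝ) × ℂ → ℂ := fun p => ∑' n, (p.1 n : ℂ) * p.2 ^ (n + 1)
  have hbound (n : ℕ) : ∀ p ∈ K, ‖(p.1 n : ℂ) * p.2 ^ (n + 1)‖ ≤ C * ρ ^ (n + 1) := by
    rintro p ⟨hp, hpρ⟩
    have hpC : ‖(p.1 n : ℂ)‖ ≤ C := Complex.norm_real _ ▸ hC _ (hp n trivial)
    rw [norm_mul, norm_pow]
    exact mul_le_mul hpC (pow_le_pow_left₀ (norm_nonneg _) (mem_closedBall_zero_iff.1 hpρ) _)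
      (by positivity) ((norm_nonneg _).trans hpC)
  have hsum : Summable fun n => C * ρ ^ (n + 1) :=
    ((summable_nat_add_iff 1).2 (summable_geometric_of_lt_one hρ₀ hρ)).mul_left C
  have hK : IsCompact K := (isCompact_univ_pi fun _ => hI).prod (isCompact_closedBall 0 ρ)
  have hF : ContinuousOn F K := continuousOn_tsum (fun n => by fun_prop) hsum hbound
  have hzeros : IsCompact (K ∩ F ⁻¹' {-1}) :=
    hK.of_isClosed_subset (hF.preimage_isClosed_of_isClosed hK.isClosed isClosed_singleton)
      Set.inter_subset_left
  convert hzeros.image continuous_snd using 1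
  ext z
  constructor
  · rintro ⟨hz, hzρ⟩
    obtain ⟨-, b, hb, hs⟩ := mem_zeroSet_iff.1 hz
    exact ⟨(b, z), ⟨⟨fun n _ => hb n, hzρ⟩, hs.tsum_eq⟩, rfl⟩
  · rintro ⟨p, ⟨hp, hpF⟩, rfl⟩
    refine ⟨mem_zeroSet_iff.2 ⟨(mem_closedBall_zero_iff.1 hp.2).trans_lt hρ, p.1,
      fun n => hp.1 n trivial, ?_⟩, hp.2⟩
    have hsp : HasSum (fun n => (p.1 n : ℂ) * p.2 ^ (n + 1)) (F p) :=
      (hsum.of_norm_bounded fun n => hbound n p hp).hasSum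
    rwa [show F p = -1 from hpF] at hsp

/-- The union of the closed unit disk and of the points `-z⁻¹` for `z ∈ 𝓖_I`; with `I = [0, 1]`
it is the common value of `Φ(E₁)`, `Φ̂(E₁)` and `Φ*(E₁)`. -/
def limitSet (I : Set ℝ) : Set ℂ :=
  closure (Metric.ball 0 1) ∪ -(zeroSet I)⁻¹

theorem mem_limitSet_iff {w : ℂ} : w ∈ limitSet I ↔ ‖w‖ ≤ 1 ∨ -w⁻¹ ∈ zeroSet I := by
  rw [limitSet, closure_ball _ one_ne_zero, Set.mem_union, mem_closedBall_zero_iff, Set.mem_neg,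
    Set.mem_inv, inv_neg]

theorem isClosed_limitSet (hI : IsCompact I) : IsClosed (limitSet I) := by
  refine isClosed_of_closure_subset fun w hw => mem_limitSet_iff.2 (or_iff_not_imp_left.2 ?_)
  intro hw₁
  obtain ⟨s, hs₁, hsw⟩ := exists_between (not_le.1 hw₁)
  have hs₀ : 0 < s := one_pos.trans hs₁
  have hclosed := (isCompact_zeroSet_inter_closedBall hI (inv_lt_one_of_one_lt₀ hs₁)).isClosed
  have hw₀ : w ≠ 0 := norm_pos_iff.1 (hs₀.trans hsw)
  have htend : Tendsto (fun u : ℂ => -u⁻¹) (𝓝 w) (𝓝 (-w⁻¹)) := (tendsto_inv₀ hw₀).neg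
  have hfar : ∀ᶠ u in 𝓝 w, s < ‖u‖ := continuous_norm.continuousAt.eventually (lt_mem_nhds hsw)
  refine (hclosed.mem_of_frequently_of_tendsto ?_ htend).1
  refine ((mem_closure_iff_frequently.1 hw).and_eventually hfar).mono fun u ⟨hu, hsu⟩ => ?_
  refine ⟨(mem_limitSet_iff.1 hu).resolve_left (hs₁.trans hsu).not_ge, ?_⟩
  rw [mem_closedBall_zero_iff, norm_neg, norm_inv]
  exact inv_anti₀ hs₀ hsu.le

end Closed

section Hurwitz

theorem exists_zero_of_norm_lt_norm_frontier {f : ℂ → ℂ} {U : Set ℂ} {c : ℂ}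
    (hU : Bornology.IsBounded U) (hf : DiffContOnCl ℂ f U) (hc : c ∈ U)
    (hlt : ∀ w ∈ frontier U, ‖f c‖ < ‖f w‖) : ∃ z ∈ U, f z = 0 := by
  by_contra! hne
  have hne' : ∀ z ∈ closure U, f z ≠ 0 := fun z hz => by
    by_cases hzU : z ∈ U
    · exact hne z hzU
    · exact norm_pos_iff.1 ((norm_nonneg _).trans_lt
        (hlt z ⟨hz, fun h => hzU (interior_subset h)⟩))
  obtain ⟨w, hw, hmax⟩ :=
    Complex.exists_mem_frontier_isMaxOn_norm hU ⟨c, hc⟩ (hf.inv hne')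
  have hle : ‖f c‖⁻¹ ≤ ‖f w‖⁻¹ := by simpa using hmax (subset_closure hc)
  have hc₀ : 0 < ‖f c‖ := norm_pos_iff.2 (hne c hc)
  exact (hlt w hw).not_ge ((inv_le_inv₀ hc₀ (hc₀.trans (hlt w hw))).1 hle)

theorem eventually_exists_zero_of_tendstoLocallyUniformlyOn {ι : Type*} {l : Filter ι}
    {F : ι → ℂ → ℂ} {f : ℂ → ℂ} {U V : Set ℂ} {z₀ : ℂ}
    (hF : TendstoLocallyUniformlyOn F f l U) (hFd : ∀ i, DifferentiableOn ℂ (F i) U)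
    (hU : IsOpen U) (hUc : IsPreconnected U) (hf : ∃ z ∈ U, f z ≠ 0) (hz₀ : z₀ ∈ U)
    (hf₀ : f z₀ = 0) (hV : V ∈ 𝓝 z₀) : ∀ᶠ i in l, ∃ z ∈ V, F i z = 0 := by
  rcases l.eq_or_neBot with rfl | _
  · simp
  have hfd : DifferentiableOn ℂ f U := hF.differentiableOn (Eventually.of_forall hFd) hU
  have hne : ∀ᶠ z in 𝓝 z₀, z ≠ z₀ → f z ≠ 0 := by
    obtain ⟨z, hz, hfz⟩ := hf
    refine eventually_nhdsWithin_iff.1 ((hfd.analyticAt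
      (hU.mem_nhds hz₀)).eventually_eq_zero_or_eventually_ne_zero.resolve_left fun h => hfz ?_)
    exact (hfd.analyticOnNhd hU).eqOn_zero_of_preconnected_of_eventuallyEq_zero hUc hz₀ h hz
  obtain ⟨r, hr, hball⟩ := Metric.nhds_basis_closedBall.eventually_iff.1
    ((hne.and (hU.mem_nhds hz₀)).and hV)
  have hrU : Metric.closedBall z₀ r ⊆ U := fun z hz => (hball hz).1.2
  obtain ⟨m, hm, hmf⟩ : ∃ m > 0, ∀ w ∈ Metric.sphere z₀ r, m ≤ ‖f w‖ := by
    refine (isCompact_sphere z₀ r).exists_forall_le'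
      (hfd.continuousOn.mono (Metric.sphere_subset_closedBall.trans hrU)).norm fun w hw => ?_
    exact norm_pos_iff.2
      ((hball (Metric.sphere_subset_closedBall hw)).1.1 (Metric.ne_of_mem_sphere hw hr.ne'))
  have hunif := (tendstoLocallyUniformlyOn_iff_forall_isCompact hU).1 hF _ hrU
    (isCompact_closedBall z₀ r)
  filter_upwards [Metric.tendstoUniformlyOn_iff.1 hunif (m / 2) (half_pos hm)] with i hi
  have hi' (z : ℂ) (hz : z ∈ Metric.closedBall z₀ r) : ‖f z - F i z‖ < m / 2 :=
    dist_eq_norm (f z) (F i z) ▸ hi z hz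
  obtain ⟨z, hz, hz0⟩ := exists_zero_of_norm_lt_norm_frontier Metric.isBounded_ball
    (((hFd i).mono hrU).diffContOnCl_ball subset_rfl) (Metric.mem_ball_self hr) fun w hw => by
      rw [frontier_ball _ hr.ne'] at hw
      have h₀ : ‖F i z₀‖ < m / 2 := by
        simpa [hf₀] using hi' z₀ (Metric.mem_closedBall_self hr.le)
      have h₁ := hi' w (Metric.sphere_subset_closedBall hw)
      have h₂ := hmf w hw
      have h₃ := norm_sub_norm_le (f w) (F i w)
      linarith
  exact ⟨z, (hball (Metric.ball_subset_closedBall hz)).2, hz0⟩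

end Hurwitz

section SimpleNumbers

/-- The monic polynomial `X ^ N + b_{N-1} X ^ (N-1) + ⋯ + b_0`. It vanishes at `-β` when the first
`N` digits of `1` in base `β` are `b_{N-1}, …, b_0` and the expansion stops there. -/
noncomputable def digitPoly (b : ℕ → ℕ) (N : ℕ) : ℤ[X] :=
  Polynomial.X ^ N + ∑ j ∈ Finset.range N, Polynomial.C (b j : ℤ) * Polynomial.X ^ j

/-- The points obtained from `0` by successively applying the inverse branches `x ↦ (b_j - x) / β`
of the negative `β`-transformation; read backwards, they form an orbit of it. -/
noncomputable def digitOrbit (β : ℝ) (b : ℕ → ℕ) : ℕ → ℝ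
  | 0 => 0
  | j + 1 => (b j - digitOrbit β b j) / β

variable {β : ℝ} {b : ℕ → ℕ} {D n N : ℕ}

theorem aeval_digitPoly {A : Type*} [CommRing A] (x : A) :
    Polynomial.aeval x (digitPoly b N) = x ^ N + ∑ j ∈ Finset.range N, (b j : A) * x ^ j := by
  simp [digitPoly]

theorem aeval_neg_digitPoly (hβ : β ≠ 0) :
    Polynomial.aeval (-β) (digitPoly b N) = (-β) ^ N * (1 - digitOrbit β b N) := by
  have hsum : ∑ j ∈ Finset.range N, (b j : ℝ) * (-β) ^ j = -((-β) ^ N * digitOrbit β b N) := by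
    induction N with
    | zero => simp [digitOrbit]
    | succ N ih =>
      rw [Finset.sum_range_succ, ih, digitOrbit]
      field_simp
      ring
  rw [aeval_digitPoly, hsum]
  ring

theorem digitOrbit_succ_mem_Ioo (hβ : D ≤ β) (hb : ∀ j < n, 1 ≤ b j ∧ b j < D) {j : ℕ}
    (hj : j < n) : digitOrbit β b (j + 1) ∈ Set.Ioo 0 1 := by
  have hprev : digitOrbit β b j ∈ Set.Ico 0 1 := by
    cases j with
    | zero => simp [digitOrbit]
    | succ j => exact Set.Ioo_subset_Ico_self (digitOrbit_succ_mem_Ioo hβ hb (by lia))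
  have hb₁ : (1 : ℝ) ≤ b j := mod_cast (hb j hj).1
  have hbD : (b j : ℝ) < D := mod_cast (hb j hj).2
  have hβ₀ : 0 < β := by linarith
  exact ⟨div_pos (by linarith [hprev.2]) hβ₀, (div_lt_one hβ₀).2 (by linarith [hprev.1])⟩

theorem continuousOn_digitOrbit : ContinuousOn (fun β => digitOrbit β b N) {0}ᶜ := by
  induction N with
  | zero => exact continuousOn_const
  | succ N ih => exact (continuousOn_const.sub ih).div continuousOn_id fun _ => id

theorem exists_digitOrbit_eq_one (hn : n ≠ 0) (hb : ∀ j < n, 1 ≤ b j ∧ b j < D)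
    (hbn : b n = D + 1) : ∃ β ∈ Set.Ioo (D : ℝ) (D + 1), digitOrbit β b (n + 1) = 1 := by
  obtain ⟨m, rfl⟩ := Nat.exists_eq_succ_of_ne_zero hn
  have hD : (0 : ℝ) < D := Nat.cast_pos.2 ((Nat.zero_le _).trans_lt (hb 0 m.succ_pos).2)
  have hmem {β : ℝ} (hβ : D ≤ β) := digitOrbit_succ_mem_Ioo hβ hb m.lt_succ_self
  have hcont : ContinuousOn (fun β => digitOrbit β b (m + 2)) (Set.Icc (D : ℝ) (D + 1)) :=
    continuousOn_digitOrbit.mono fun β hβ => (hD.trans_le hβ.1).ne'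
  refine intermediate_value_Ioo' (by linarith) hcont ⟨?_, ?_⟩
  · rw [digitOrbit, hbn, div_lt_one (by linarith)]
    push_cast
    linarith [(hmem (β := D + 1) (by linarith)).1]
  · rw [digitOrbit, hbn, lt_div_iff₀ hD]
    push_cast
    linarith [(hmem le_rfl).2]

theorem tau_E₁_natCast_sub_div (hβ : β ≠ 0) {x : ℝ} (hx : x ∈ Set.Ioc 0 1) (d : ℕ) :
    tau β E₁ ((d - x) / β) = x := by
  have hfract : Int.fract ((d : ℝ) - x) = 1 - x :=
    Int.fract_eq_iff.2 ⟨by linarith [hx.2], by linarith [hx.1], d - 1, by push_cast; ring⟩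
  rw [tau_E₁, mul_div_cancel₀ _ hβ, hfract, sub_sub_cancel]

theorem orbitPt_E₁_eq_digitOrbit (hβ : β ≠ 0) (h₁ : digitOrbit β b (n + 1) = 1)
    (h : ∀ j < n, digitOrbit β b (j + 1) ∈ Set.Ioc 0 1) {k : ℕ} (hk : k ≤ n) :
    orbitPt β E₁ k = digitOrbit β b (n + 1 - k) := by
  induction k with
  | zero => exact h₁.symm
  | succ k ih =>
    obtain ⟨j, rfl⟩ := Nat.exists_eq_add_of_lt hk
    rw [orbitPt_succ, ih (by lia), show k + j + 1 + 1 - k = j + 1 + 1 by lia,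
      show k + j + 1 + 1 - (k + 1) = j + 1 by lia, digitOrbit,
      tau_E₁_natCast_sub_div hβ (h j (by lia))]

theorem exists_isSimpleGenParry_of_digits (hn : n ≠ 0) (hb : ∀ j < n, 1 ≤ b j ∧ b j < D)
    (hbn : b n = D + 1) :
    ∃ β ∈ Set.Ioo (D : ℝ) (D + 1), IsSimpleGenParry β E₁ ∧
      Polynomial.aeval (-β) (digitPoly b (n + 1)) = 0 := by
  obtain ⟨β, hβ, h₁⟩ := exists_digitOrbit_eq_one hn hb hbn
  obtain ⟨hb₁, hbD⟩ := hb 0 (Nat.pos_of_ne_zero hn)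
  have hβ₁ : 1 < β := (Nat.one_lt_cast.2 (hb₁.trans_lt hbD)).trans hβ.1
  have hβ₀ : 0 < β := one_pos.trans hβ₁
  have hbase : IsBase β := by
    refine ⟨hβ₁, ?_⟩
    rintro k rfl
    exact absurd (Int.lt_add_one_iff.1 (by exact_mod_cast hβ.2)) (not_le.2 (mod_cast hβ.1))
  have hend : orbitPt β E₁ n = b 0 / β := by
    rw [orbitPt_E₁_eq_digitOrbit hβ₀.ne' h₁
      (fun j hj => Set.Ioo_subset_Ioc_self (digitOrbit_succ_mem_Ioo hβ.1.le hb hj)) le_rfl]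
    simp [digitOrbit]
  have hsimple : IsSimple β E₁ :=
    ⟨n, Nat.one_le_iff_ne_zero.2 hn, b 0, hb₁,
      Nat.le_floor ((Nat.cast_lt.2 hbD).trans hβ.1).le, hend⟩
  refine ⟨β, hβ, ⟨⟨hbase, finite_range_orbitPt_of_isSimple hβ₀ hsimple⟩, hsimple⟩, ?_⟩
  rw [aeval_neg_digitPoly hβ₀.ne', h₁, sub_self, mul_zero]

theorem degree_digitPoly_tail_lt :
    (∑ j ∈ Finset.range N, Polynomial.C (b j : ℤ) * Polynomial.X ^ j).degree <
      (N : WithBot ℕ) := by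
  simp_rw [← Fin.sum_univ_eq_sum_range (fun j => Polynomial.C (b j : ℤ) * Polynomial.X ^ j) N]
  exact Polynomial.degree_sum_fin_lt _

theorem monic_digitPoly : (digitPoly b N).Monic :=
  Polynomial.monic_X_pow_add degree_digitPoly_tail_lt

theorem natDegree_digitPoly : (digitPoly b N).natDegree = N := by
  rw [digitPoly, Polynomial.natDegree_add_eq_left_of_degree_lt, Polynomial.natDegree_X_pow]
  exact (Polynomial.degree_X_pow (R := ℤ) N).symm ▸ degree_digitPoly_tail_lt

theorem coeff_digitPoly (j : ℕ) :
    (digitPoly b N).coeff j = if j < N then (b j : ℤ) else if j = N then 1 else 0 := by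
  simp only [digitPoly, Polynomial.coeff_add, Polynomial.coeff_X_pow, Polynomial.finsetSum_coeff,
    Polynomial.coeff_C_mul_X_pow, Finset.sum_ite_eq, Finset.mem_range]
  split_ifs <;> lia

theorem irreducible_digitPoly (hN : N ≠ 0) (hb : ∀ j < N, 2 ∣ b j) (hb₀ : ¬ 4 ∣ b 0) :
    Irreducible (digitPoly b N) := by
  have hEis : (digitPoly b N).IsEisensteinAt (Ideal.span {2}) := by
    refine ⟨?_, fun {j} hj => ?_, ?_⟩
    · rw [monic_digitPoly.leadingCoeff, Ideal.mem_span_singleton]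
      norm_num
    · rw [natDegree_digitPoly] at hj
      rw [coeff_digitPoly, if_pos hj, Ideal.mem_span_singleton]
      exact_mod_cast hb j hj
    · rw [coeff_digitPoly, if_pos (Nat.pos_of_ne_zero hN), Ideal.span_singleton_pow,
        Ideal.mem_span_singleton]
      exact_mod_cast hb₀
  have hprime : (Ideal.span {(2 : ℤ)}).IsPrime :=
    (Ideal.span_singleton_prime two_ne_zero).2 Int.prime_two
  exact hEis.irreducible hprime monic_digitPoly.isPrimitive
    (natDegree_digitPoly ▸ Nat.pos_of_ne_zero hN)

theorem neg_mem_rootSet_minpoly {p : ℤ[X]} (hp : p.Monic) (hirr : Irreducible p) {v : ℂ}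
    (hβ : Polynomial.aeval (-β) p = 0) (hv : Polynomial.aeval v p = 0) :
    -v ∈ (minpoly ℚ β).rootSet ℂ := by
  have hmin : minpoly ℚ (-β) = p.map (algebraMap ℤ ℚ) :=
    (minpoly.eq_of_irreducible_of_monic
      ((hp.irreducible_iff_irreducible_map_fraction_map (K := ℚ)).1 hirr)
      (by rwa [Polynomial.aeval_map_algebraMap]) (hp.map _)).symm
  have hint : IsIntegral ℚ β :=
    (IsIntegral.tower_top (A := ℚ) (⟨p, hp, hβ⟩ : IsIntegral ℤ (-β))).of_neg
  refine Polynomial.mem_rootSet.2 ⟨minpoly.ne_zero hint, ?_⟩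
  rw [← neg_neg β, minpoly.neg, hmin, map_mul, Polynomial.aeval_comp, map_neg, Polynomial.aeval_X,
    neg_neg, Polynomial.aeval_map_algebraMap, hv, mul_zero]

theorem neg_mem_Phi_of_digits (hn : n ≠ 0) (hb : ∀ j < n, 1 ≤ b j ∧ b j < D)
    (hbn : b n = D + 1) (hb₂ : ∀ j ≤ n, 2 ∣ b j) (hb₄ : ¬ 4 ∣ b 0) {v : ℂ} (hvD : ‖v‖ ≤ D)
    (hv : Polynomial.aeval v (digitPoly b (n + 1)) = 0) : -v ∈ Phi E₁ := by
  obtain ⟨β, hβ, hsimple, hroot⟩ := exists_isSimpleGenParry_of_digits hn hb hbn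
  refine subset_closure ⟨β, hsimple, neg_mem_rootSet_minpoly monic_digitPoly
    (irreducible_digitPoly n.succ_ne_zero (fun j hj => hb₂ j (Nat.lt_succ_iff.1 hj)) hb₄)
    hroot hv, fun h => ?_⟩
  have hnorm : ‖v‖ = |β| := by rw [← norm_neg, h, Complex.norm_real, Real.norm_eq_abs]
  linarith [le_abs_self β, hβ.1]

end SimpleNumbers

section Approximation

theorem tendstoLocallyUniformly_eval {ι : Type*} {l : Filter ι} {p : ι → ℂ[X]} {q : ℂ[X]} {N : ℕ}
    (hp : ∀ i, (p i).natDegree < N) (hq : q.natDegree < N)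
    (hpq : ∀ j, Tendsto (fun i => (p i).coeff j) l (𝓝 (q.coeff j))) :
    TendstoLocallyUniformly (fun i z => (p i).eval z) (fun z => q.eval z) l := by
  simp only [fun i z => Polynomial.eval_eq_sum_range' (hp i) z, Polynomial.eval_eq_sum_range' hq]
  let G : C((ℕ → ℂ) × ℂ, ℂ) := ⟨fun x => ∑ j ∈ Finset.range N, x.1 j * x.2 ^ j, by fun_prop⟩
  exact ContinuousMap.tendsto_iff_tendstoLocallyUniformly.1
    ((G.curry.continuous.tendsto q.coeff).comp (tendsto_pi_nhds.2 hpq))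

theorem eventually_exists_isRoot {ι : Type*} {l : Filter ι} {p : ι → ℂ[X]} {q : ℂ[X]} {N : ℕ}
    (hp : ∀ i, (p i).natDegree < N) (hq : q.natDegree < N)
    (hpq : ∀ j, Tendsto (fun i => (p i).coeff j) l (𝓝 (q.coeff j))) (hq₀ : q ≠ 0) {v : ℂ}
    (hv : q.IsRoot v) {V : Set ℂ} (hV : V ∈ 𝓝 v) : ∀ᶠ i in l, ∃ z ∈ V, (p i).IsRoot z := by
  obtain ⟨z, hz⟩ : ∃ z, q.eval z ≠ 0 := by
    by_contra! h
    exact hq₀ (Polynomial.funext fun z => by rw [h, Polynomial.eval_zero])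
  exact eventually_exists_zero_of_tendstoLocallyUniformlyOn
    (tendstoLocallyUniformlyOn_univ.2 (tendstoLocallyUniformly_eval hp hq hpq))
    (fun i => (p i).differentiable.differentiableOn) isOpen_univ isPreconnected_univ
    ⟨z, trivial, hz⟩ (Set.mem_univ v) hv hV

/-- The roots of the monic polynomials with coefficients in `[0, 1]`. -/
def unitIntervalRoots : Set ℂ :=
  {v | ∃ p : ℝ[X], p.Monic ∧ (∀ j, p.coeff j ∈ Set.Icc (0 : ℝ) 1) ∧ Polynomial.aeval v p = 0}

/-- Even digits for which `digitPoly` satisfies Eisenstein's criterion at `2` and, divided by `4t`,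
tends to the monic polynomial `P` as `t` tends to infinity. -/
noncomputable def approxDigits (P : ℝ[X]) (t j : ℕ) : ℕ :=
  if j < P.natDegree then 2 + 4 * ⌊P.coeff j * t⌋₊ else 4 * t + 4

theorem tendsto_coeff_digitPoly_approxDigits {P : ℝ[X]} (hP : P.Monic)
    (hcoeff : ∀ j, 0 ≤ P.coeff j) (j : ℕ) :
    Tendsto (fun t : ℕ =>
        ((digitPoly (approxDigits P t) (P.natDegree + 1)).coeff j : ℝ) / (4 * t)) atTop
      (𝓝 (P.coeff j)) := by
  have hinv (a : ℝ) : Tendsto (fun t : ℕ => a / (t : ℝ)) atTop (𝓝 0) :=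
    tendsto_const_div_atTop_nhds_zero_nat a
  rcases lt_trichotomy j P.natDegree with hj | rfl | hj
  · have hfloor := (tendsto_nat_floor_mul_div_atTop (hcoeff j)).comp
      (tendsto_natCast_atTop_atTop (R := ℝ))
    convert (hinv (1 / 2)).add hfloor using 2 with t
    · rw [coeff_digitPoly, if_pos (by lia), approxDigits, if_pos hj, Function.comp_apply]
      push_cast
      ring
    · rw [zero_add]
  · rw [hP.coeff_natDegree]
    have h : Tendsto (fun t : ℕ => 1 + 1 / (t : ℝ)) atTop (𝓝 1) := by
      simpa only [add_zero] using (hinv 1).const_add 1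
    refine h.congr' ((eventually_ne_atTop 0).mono fun t ht => ?_)
    dsimp only
    rw [coeff_digitPoly, if_pos (by lia), approxDigits, if_neg (lt_irrefl _)]
    push_cast
    field_simp
  · simp only [coeff_digitPoly, if_neg (show ¬ j < P.natDegree + 1 by lia)]
    rw [Polynomial.coeff_eq_zero_of_natDegree_lt hj]
    convert hinv ((if j = P.natDegree + 1 then 1 else 0) / 4) using 2 with t
    push_cast
    ring

theorem neg_mem_Phi_of_aeval_digitPoly_approxDigits {P : ℝ[X]}
    (hcoeff : ∀ j, P.coeff j ∈ Set.Icc (0 : ℝ) 1) (hP₀ : P.natDegree ≠ 0) {t : ℕ} {v : ℂ}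
    (hvt : ‖v‖ ≤ t)
    (hv : Polynomial.aeval v (digitPoly (approxDigits P t) (P.natDegree + 1)) = 0) :
    -v ∈ Phi E₁ := by
  have hlt {j : ℕ} (hj : j < P.natDegree) : approxDigits P t j = 2 + 4 * ⌊P.coeff j * t⌋₊ :=
    if_pos hj
  have hn : approxDigits P t P.natDegree = 4 * t + 4 := if_neg (lt_irrefl _)
  have hfloor (j : ℕ) : ⌊P.coeff j * t⌋₊ ≤ t :=
    Nat.floor_le_of_le (mul_le_of_le_one_left t.cast_nonneg (hcoeff j).2)
  refine neg_mem_Phi_of_digits hP₀ (D := 4 * t + 3) (fun j hj => ?_) hn (fun j hj => ?_) ?_ ?_ hv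
  · have := hfloor j
    rw [hlt hj]
    lia
  · rcases hj.lt_or_eq with hj | rfl
    · rw [hlt hj]
      lia
    · rw [hn]
      lia
  · rw [hlt (Nat.pos_of_ne_zero hP₀)]
    lia
  · push_cast
    linarith [t.cast_nonneg (α := ℝ)]

theorem neg_mem_Phi_of_mem_unitIntervalRoots {v : ℂ} (hv : v ∈ unitIntervalRoots) :
    -v ∈ Phi E₁ := by
  obtain ⟨P, hP, hcoeff, hroot⟩ := hv
  have hP₀ : P.natDegree ≠ 0 := fun h => by
    simp [(hP.natDegree_eq_zero).1 h] at hroot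
  let p (t : ℕ) : ℂ[X] := Polynomial.C ((4 * t : ℂ)⁻¹) *
    (digitPoly (approxDigits P t) (P.natDegree + 1)).map (algebraMap ℤ ℂ)
  have hdeg (t : ℕ) : (p t).natDegree < P.natDegree + 2 := by
    refine (Polynomial.natDegree_C_mul_le _ _).trans_lt ?_
    rw [monic_digitPoly.natDegree_map, natDegree_digitPoly]
    lia
  have htend (j : ℕ) : Tendsto (fun t => (p t).coeff j) atTop
      (𝓝 ((P.map (algebraMap ℝ ℂ)).coeff j)) := by
    rw [Polynomial.coeff_map]
    refine ((Complex.continuous_ofReal.tendsto _).comp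
      (tendsto_coeff_digitPoly_approxDigits hP (fun j => (hcoeff j).1) j)).congr fun t => ?_
    simp only [p, Polynomial.coeff_C_mul, Polynomial.coeff_map]
    simp [div_eq_inv_mul]
  suffices h : v ∈ closure {z | -z ∈ Phi E₁} from
    ((isClosed_closure : IsClosed (Phi E₁)).preimage continuous_neg).closure_subset h
  refine mem_closure_iff_nhds.2 fun V hV => ?_
  have hnear : ∀ᶠ z in 𝓝 v, z ∈ V ∧ ‖z‖ < ‖v‖ + 1 :=
    (show ∀ᶠ z in 𝓝 v, z ∈ V from hV).and
      (continuous_norm.continuousAt.eventually (gt_mem_nhds (lt_add_one _)))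
  obtain ⟨t, ⟨z, ⟨hzV, hz⟩, hzt⟩, ht, ht₀⟩ := ((eventually_exists_isRoot hdeg
    (by rw [hP.natDegree_map]; lia) htend (hP.map _).ne_zero
    (by rwa [Polynomial.IsRoot, Polynomial.eval_map_algebraMap]) hnear).and
    ((tendsto_natCast_atTop_atTop.eventually_ge_atTop (‖v‖ + 1)).and
      (eventually_ne_atTop 0))).exists
  refine ⟨z, hzV, neg_mem_Phi_of_aeval_digitPoly_approxDigits hcoeff hP₀ (hz.le.trans ht) ?_⟩
  rw [Polynomial.IsRoot, Polynomial.eval_mul, Polynomial.eval_C, Polynomial.eval_map_algebraMap]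
    at hzt
  exact (mul_eq_zero.1 hzt).resolve_left (by simpa using ht₀)

theorem neg_mem_Phi_of_mem_closure_unitIntervalRoots {v : ℂ} (hv : v ∈ closure unitIntervalRoots) :
    -v ∈ Phi E₁ :=
  closure_minimal (fun _ => neg_mem_Phi_of_mem_unitIntervalRoots)
    ((isClosed_closure : IsClosed (Phi E₁)).preimage continuous_neg) hv

theorem mem_closure_unitIntervalRoots_of_norm_le_one {v : ℂ} (hv : ‖v‖ ≤ 1) :
    v ∈ closure unitIntervalRoots := by
  let θ : ℕ → ℝ := fun m => (Real.pi - (v ^ m).arg) / m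
  have hθ : Tendsto θ atTop (𝓝 0) :=
    tendsto_bdd_div_atTop_nhds_zero (b := 0) (B := 2 * Real.pi)
      (Eventually.of_forall fun m => by linarith [Complex.arg_le_pi (v ^ m)])
      (Eventually.of_forall fun m => by linarith [Complex.neg_pi_lt_arg (v ^ m)])
      tendsto_natCast_atTop_atTop
  have htend : Tendsto (fun m => v * Complex.exp (θ m * Complex.I)) atTop (𝓝 v) := by
    have hcont : Continuous fun x : ℝ => v * Complex.exp (x * Complex.I) := by fun_prop
    simpa [Function.comp_def] using (hcont.tendsto 0).comp hθ
  refine mem_closure_of_tendsto htend ((eventually_ne_atTop 0).mono fun m hm => ?_)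
  have hpow : (v * Complex.exp (θ m * Complex.I)) ^ m = -(‖v‖ : ℂ) ^ m := by
    have hθm : (m : ℂ) * (θ m * Complex.I) = Real.pi * Complex.I - (v ^ m).arg * Complex.I := by
      simp only [θ]
      push_cast
      field_simp
    rw [mul_pow, ← Complex.exp_nat_mul, hθm, Complex.exp_sub, Complex.exp_pi_mul_I, ← mul_div_assoc,
      div_eq_iff (Complex.exp_ne_zero _), mul_neg_one, neg_mul, ← Complex.ofReal_pow, ← norm_pow,
      Complex.norm_mul_exp_arg_mul_I]
  have hvm : ‖v‖ ^ m ∈ Set.Icc (0 : ℝ) 1 := ⟨by positivity, pow_le_one₀ (norm_nonneg v) hv⟩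
  refine ⟨Polynomial.X ^ m + Polynomial.C (‖v‖ ^ m), Polynomial.monic_X_pow_add_C _ hm,
    fun j => ?_, by simp [hpow]⟩
  rw [Polynomial.coeff_add, Polynomial.coeff_X_pow, Polynomial.coeff_C]
  split_ifs with hjm hj₀
  · exact absurd (hjm.symm.trans hj₀) hm
  · simp
  · simpa using hvm
  · simp

theorem inv_mem_unitIntervalRoots {p : ℝ[X]} (hp₀ : p.coeff 0 = 1)
    (hp : ∀ j, p.coeff j ∈ Set.Icc (0 : ℝ) 1) {z : ℂ} (hz : Polynomial.aeval z p = 0) :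
    z⁻¹ ∈ unitIntervalRoots := by
  have hz₀ : z ≠ 0 := by
    rintro rfl
    simp [← Polynomial.coeff_zero_eq_aeval_zero', hp₀] at hz
  refine ⟨p.reverse, ?_, fun j => Polynomial.coeff_reverse p j ▸ hp _, ?_⟩
  · rw [Polynomial.Monic, Polynomial.reverse_leadingCoeff, Polynomial.trailingCoeff,
      Polynomial.natTrailingDegree_eq_zero.2 (Or.inr (by simp [hp₀])), hp₀]
  · let _ := invertibleOfNonzero hz₀
    rw [← invOf_eq_inv]
    exact (Polynomial.eval₂_reverse_eq_zero_iff _ _ _).2 hz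

theorem tendstoLocallyUniformlyOn_aeval_trunc {f : ℝ⟦X⟧} {C : ℝ}
    (hf : ∀ n, |PowerSeries.coeff n f| ≤ C) :
    TendstoLocallyUniformlyOn (fun N z => Polynomial.aeval z (PowerSeries.trunc N f))
      (fun z : ℂ => ∑' n, ((PowerSeries.coeff n f : ℝ) : ℂ) * z ^ n) atTop (Metric.ball 0 1) := by
  refine (tendstoLocallyUniformlyOn_iff_forall_isCompact Metric.isOpen_ball).2 fun K hK hKc => ?_
  obtain ⟨r, ⟨hr₀, hr₁⟩, hKr⟩ := exists_pos_lt_subset_ball one_pos hKc.isClosed hK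
  simp only [Polynomial.aeval_def, PowerSeries.eval₂_trunc_eq_sum_range]
  refine tendstoUniformlyOn_tsum_nat
    ((summable_geometric_of_lt_one hr₀.le hr₁).mul_left C) fun n z hz => ?_
  have hzr : ‖z‖ ≤ r := (mem_ball_zero_iff.1 (hKr hz)).le
  rw [norm_mul, norm_pow, norm_algebraMap', Real.norm_eq_abs]
  exact mul_le_mul (hf n) (pow_le_pow_left₀ (norm_nonneg z) hzr n) (by positivity)
    ((abs_nonneg _).trans (hf n))

theorem inv_mem_closure_unitIntervalRoots {z : ℂ} (hz : z ∈ zeroSet (Set.Icc 0 1)) :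
    z⁻¹ ∈ closure unitIntervalRoots := by
  obtain ⟨hz₁, f, ⟨hf₀, hf⟩, hfz⟩ := hz
  have hcoeff (n : ℕ) : PowerSeries.coeff n f ∈ Set.Icc (0 : ℝ) 1 := by
    rcases n.eq_zero_or_pos with rfl | hn
    · simp [hf₀]
    · exact hf n hn
  have hf₁ (n : ℕ) : |PowerSeries.coeff n f| ≤ 1 := by
    rw [abs_of_nonneg (hcoeff n).1]
    exact (hcoeff n).2
  have hzero : ∑' n, ((PowerSeries.coeff n f : ℝ) : ℂ) * 0 ^ n ≠ 0 := by
    rw [tsum_eq_single 0 fun n hn => by rw [zero_pow hn, mul_zero], hf₀]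
    simp
  have hz₀ : z ≠ 0 := by
    rintro rfl
    exact hzero hfz.tsum_eq
  refine mem_closure_iff_nhds.2 fun V hV => ?_
  have hroots := eventually_exists_zero_of_tendstoLocallyUniformlyOn
    (tendstoLocallyUniformlyOn_aeval_trunc hf₁)
    (fun N => (PowerSeries.trunc N f).differentiableOn_aeval) Metric.isOpen_ball
    (convex_ball 0 1).isPreconnected ⟨0, Metric.mem_ball_self one_pos, hzero⟩ hz₁ hfz.tsum_eq
    (tendsto_inv₀ hz₀ hV)
  obtain ⟨N, ⟨w, hw, hroot⟩, hN⟩ := (hroots.and (eventually_gt_atTop 0)).exists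
  refine ⟨w⁻¹, hw, inv_mem_unitIntervalRoots ?_ (fun j => ?_) hroot⟩
  · rw [PowerSeries.coeff_trunc, if_pos hN, hf₀]
  · rw [PowerSeries.coeff_trunc]
    split_ifs
    · exact hcoeff j
    · simp

end Approximation

section Inclusions

variable (E : ℕ → Fin 2)

theorem Phi_subset_PhiHat : Phi E ⊆ PhiHat E :=
  closure_mono fun _ ⟨β, hβ, hz⟩ => ⟨β, hβ.1, hz⟩

theorem Phi_subset_PhiStar : Phi E ⊆ PhiStar E :=
  closure_mono fun γ ⟨β, hβ, hγ⟩ => ⟨β, hβ.1.1, γ⁻¹, hβ.1.isZeroOf_inv hγ (Or.inr hβ.2),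
    fun h => hγ.2 (inv_injective h), (inv_inv γ).symm⟩

theorem inv_mem_limitSet_of_isZeroOf {β : ℝ} (hβ : 0 < β) {z : ℂ}
    (hz : IsZeroOf (1 - phi β E₁) z) (hzβ : z ≠ (β : ℂ)⁻¹) : z⁻¹ ∈ limitSet (Set.Icc 0 1) := by
  refine mem_limitSet_iff.2 (or_iff_not_imp_left.2 fun h => ?_)
  rw [inv_inv]
  refine neg_mem_zeroSet_of_isZeroOf hβ hz hzβ ?_
  rw [← inv_inv z, norm_inv]
  exact inv_lt_one_of_one_lt₀ (not_le.1 h)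

theorem PhiStar_E₁_subset_limitSet : PhiStar E₁ ⊆ limitSet (Set.Icc 0 1) := by
  refine closure_minimal ?_ (isClosed_limitSet isCompact_Icc)
  rintro _ ⟨β, hβ, z, hz, hzβ, rfl⟩
  exact inv_mem_limitSet_of_isZeroOf (one_pos.trans hβ.1) hz hzβ

theorem PhiHat_E₁_subset_limitSet : PhiHat E₁ ⊆ limitSet (Set.Icc 0 1) := by
  refine closure_minimal ?_ (isClosed_limitSet isCompact_Icc)
  rintro γ ⟨β, hβ, hγ⟩
  rcases le_or_gt ‖γ‖ 1 with h | h
  · exact mem_limitSet_iff.2 (Or.inl h)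
  · rw [← inv_inv γ]
    exact inv_mem_limitSet_of_isZeroOf (one_pos.trans hβ.1.1) (hβ.isZeroOf_inv hγ (Or.inl h))
      fun h => hγ.2 (inv_injective h)

theorem limitSet_subset_Phi_E₁ : limitSet (Set.Icc 0 1) ⊆ Phi E₁ := by
  intro w hw
  rw [← neg_neg w]
  refine neg_mem_Phi_of_mem_closure_unitIntervalRoots ?_
  rcases mem_limitSet_iff.1 hw with hw | hw
  · exact mem_closure_unitIntervalRoots_of_norm_le_one (by rwa [norm_neg])
  · have h := inv_mem_closure_unitIntervalRoots hw
    rwa [inv_neg, inv_inv] at h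

end Inclusions

end GenBeta

theorem theorem2p3 :
    GenBeta.Phi GenBeta.E₁ = GenBeta.PhiHat GenBeta.E₁ ∧
    GenBeta.PhiHat GenBeta.E₁ = GenBeta.PhiStar GenBeta.E₁ ∧
    GenBeta.PhiStar GenBeta.E₁ =
      closure (Metric.ball (0 : ℂ) 1) ∪ -(GenBeta.zeroSet (Set.Icc (0 : ℝ) 1))⁻¹ := by
  have hPhi := GenBeta.limitSet_subset_Phi_E₁
  have hHat := GenBeta.PhiHat_E₁_subset_limitSet
  have hStar := GenBeta.PhiStar_E₁_subset_limitSet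
  have hPhiHat := GenBeta.Phi_subset_PhiHat GenBeta.E₁
  have hPhiStar := GenBeta.Phi_subset_PhiStar GenBeta.E₁
  refine ⟨hPhiHat.antisymm (hHat.trans hPhi), ?_, hStar.antisymm (hPhi.trans hPhiStar)⟩
  exact ((hHat.trans hPhi).trans hPhiStar).antisymm ((hStar.trans hPhi).trans hPhiHat)
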